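/- Let $X\in\mathbb R^{N\times P}$, $Y\in\mathbb R^N$, $\mathcal D=(X,Y)$, and let $h\in(0,1)$ and $\tau,\nu_0,\lambda_0>0$. Consider the Bayesian model in which the inclusion variables $\gamma_1,\dots,\gamma_P\in\{0,1\}$ are i.i.d. $\mathrm{Bern}(h)$, the noise variance is $\sigma_\gamma^2\sim\mathrm{InvGamma}(\tfrac12\nu_0,\tfrac12\nu_0\lambda_0)$, the coefficients of the included covariates are $\beta_\gamma\sim\mathcal N(0,\sigma_\gamma^2\tau^{-1}I_{|\gamma|})$, and the responses are independent with $Y_n\sim\mathcal N(\beta_\gamma\cdot X_{n\gamma},\sigma_\gamma^2)$. Let $p(\gamma\mid\mathcal D)$ be the posterior of $\gamma$, let $p(\gamma_j\mid\gamma_{-j},\mathcal D)$ be its conditionals, and let $\mathrm{PIP}(i)=p(\gamma_i=1\mid\mathcal D)$. Put $$\phi(\gamma)=\frac12\sum_{j=1}^P\frac{p(\gamma_j=1\mid\gamma_{-j},\mathcal D)}{p(\gamma_j\mid\gamma_{-j},\mathcal D)},\qquad f(j\mid\gamma)=\phi(\gamma)^{-1}\,\frac{\frac12\,p(\gamma_j=1\mid\gamma_{-j},\mathcal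 D)}{p(\gamma_j\mid\gamma_{-j},\mathcal D)}.$$ The VC-wTGS algorithm with subset size $S\in(0,P]$ runs as follows. The coordinates of $\gamma^{(0)}$ are i.i.d. $\mathrm{Bern}(h)$. At iteration $t\ge1$, $Q^{(t)}$ is drawn independently of the past, with $Q^{(1)}=1$ and $Q^{(t)}\sim\mathrm{Bern}(S/P)$ for $t\ge2$. If $Q^{(t)}=1$, a coordinate is drawn from $f(\cdot\mid\gamma^{(t-1)})$, $\gamma^{(t)}$ is $\gamma^{(t-1)}$ with that coordinate flipped, and $\tilde\rho^{(t)}=\phi(\gamma^{(t)})^{-1}$. If $Q^{(t)}=0$, then $\gamma^{(t)}=\gamma^{(t-1)}$ and $\tilde\rho^{(t)}=1$. After $T$ iterations the weights are $\rho^{(t)}=\tilde\rho^{(t)}Q^{(t)}\big/\sum_{s=1}^T\tilde\rho^{(s)}Q^{(s)}$, and the Rao-Blackwellized estimator is $$E_{i,T}=\sum_{t=1}^T\rho^{(t)}\,p(\gamma_i^{(t)}=1\mid\gamma_{-i}^{(t)},\mathcal D).$$ **Theorem.** For every dataset, all hyperparameters, every $i\in\{1,\dots,P\}$ and every $S\in(0,P]$,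 the following holds. 1. $E_{i,T}\to\mathrm{PIP}(i)$ almost surely as $T\to\infty$. 2. As $T\to\infty$, $$\mathbb E\big[|E_{i,T}-\mathrm{PIP}(i)|^2\big]=O\!\left(\frac{\log T}{T}\Big(\frac PS\Big)^2\Big(\frac{\max_\gamma\phi(\gamma)}{\min_\gamma\phi(\gamma)}\Big)^2\right).$$ Precisely, there is an absolute constant $C>0$ such that, for every dataset and all hyperparameters, there is a $T_0$, which may depend on the dataset and the hyperparameters but not on $i$ or $S$, such that for all $i$, all $S\in(0,P]$ and all $T\ge T_0$ the left-hand side is at most $C$ times the expression in the $O(\cdot)$. -/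

import Mathlib

open MeasureTheory Filter Topology ProbabilityTheory

noncomputable section

/-- A Bayesian variable-selection problem with `N` observations and `P` covariates: the observed
dataset `(X, Y)` and the hyperparameters of the prior (prior inclusion probability `h`, prior
precision `τ`, and the two parameters `ν₀`, `lam₀` of the inverse-gamma prior of the noise
variance). -/
structure BVSProblem (N P : ℕ) where
  X : Matrix (Fin N) (Fin P) ℝ
  Y : Fin N → ℝ
  h : ℝ
  τ : ℝ
  ν₀ : ℝ
  lam₀ : ℝ
  h_pos : 0 < h
  h_lt_one : h < 1
  τ_pos : 0 < τ
  ν₀_pos : 0 < ν₀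
  lam₀_pos : 0 < lam₀

/-- A vector of inclusion variables `γ = (γ₁, …, γ_P) ∈ {0,1}^P`. -/
abbrev Inclusion (P : ℕ) : Type := Fin P → Bool

/-- Flip the `j`-th coordinate of `γ`. -/
def flipAt {P : ℕ} (γ : Inclusion P) (j : Fin P) : Inclusion P :=
  Function.update γ j (!γ j)

/-- Density at `s` of the inverse-gamma distribution with shape `a` and scale `b`. -/
def invGammaDensity (a b s : ℝ) : ℝ :=
  if 0 < s then b ^ a / Real.Gamma a * s ^ (-a - 1) * Real.exp (-b / s) else 0

namespace BVSProblem

variable {N P : ℕ} (D : BVSProblem N P)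

/-- Prior of `γ`: independent `Bern(h)` coordinates. -/
def prior (γ : Inclusion P) : ℝ :=
  ∏ j, if γ j = true then D.h else 1 - D.h

/-- Density of the response `Y` given `γ`, the coefficients `β_γ` (indexed by the included
covariates) and the noise variance `s = σ_γ²`: independent `N(β_γ · X_{nγ}, s)`. -/
def likelihood (γ : Inclusion P) (s : ℝ) (β : {j : Fin P // γ j = true} → ℝ) : ℝ :=
  ∏ n, gaussianPDFReal (∑ j : {j : Fin P // γ j = true}, D.X n j * β j) s.toNNReal (D.Y n)

/-- Prior density of the coefficients `β_γ` given the noise variance `s`: `N(0, s τ⁻¹ I)`. -/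
def coeffDensity (γ : Inclusion P) (s : ℝ) (β : {j : Fin P // γ j = true} → ℝ) : ℝ :=
  ∏ j, gaussianPDFReal 0 (s * D.τ⁻¹).toNNReal (β j)

/-- The marginal likelihood `p(Y | γ, X)`: the coefficients and the noise variance
are integrated out. -/
def marginalLikelihood (γ : Inclusion P) : ℝ :=
  ∫ s in Set.Ioi (0 : ℝ), invGammaDensity (D.ν₀ / 2) (D.ν₀ * D.lam₀ / 2) s *
    ∫ β : {j : Fin P // γ j = true} → ℝ, D.likelihood γ s β * D.coeffDensity γ s β

/-- The posterior `p(γ | 𝒟)`. -/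
def posterior (γ : Inclusion P) : ℝ :=
  D.prior γ * D.marginalLikelihood γ / ∑ γ', D.prior γ' * D.marginalLikelihood γ'

/-- The posterior inclusion probability `PIP(i) = p(γ_i = 1 | 𝒟)`. -/
def PIP (i : Fin P) : ℝ :=
  ∑ γ : Inclusion P with γ i = true, D.posterior γ

/-- The conditional posterior `p(γ_j = b | γ_{-j}, 𝒟)`; it does not depend on `γ j`. -/
def condPosterior (γ : Inclusion P) (j : Fin P) (b : Bool) : ℝ :=
  D.posterior (Function.update γ j b) / ∑ c : Bool, D.posterior (Function.update γ j c)

/-- The weighting function `η(γ_{-j}) = p(γ_j = 1 | γ_{-j}, 𝒟)`. -/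
def weightEta (γ : Inclusion P) (j : Fin P) : ℝ := D.condPosterior γ j true

/-- `φ(γ) = ∑_j (½ η(γ_{-j})) / p(γ_j | γ_{-j}, 𝒟)`. -/
def phi (γ : Inclusion P) : ℝ :=
  ∑ j, (1 / 2 * D.weightEta γ j) / D.condPosterior γ j (γ j)

/-- `f(j | γ) = φ(γ)⁻¹ (½ η(γ_{-j})) / p(γ_j | γ_{-j}, 𝒟)`: the probability with which
coordinate `j` is selected for the flip in state `γ`. -/
def selectProb (γ : Inclusion P) (j : Fin P) : ℝ :=
  (D.phi γ)⁻¹ * ((1 / 2 * D.weightEta γ j) / D.condPosterior γ j (γ j))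

/-- Law of `Q^{(t)}`: `Q^{(1)} = 1` and `Q^{(t)} ∼ Bern(S/P)` for `t ≥ 2`. -/
def qProb (_D : BVSProblem N P) (S : ℝ) (t : ℕ) (q : Bool) : ℝ :=
  if t = 1 then (if q = true then 1 else 0) else (if q = true then S / P else 1 - S / P)

/-- Law of `γ^{(t)}` at `γ'` given `γ^{(t-1)} = γ` and `Q^{(t)} = q`: if `q = 1`, a coordinate drawn
from `f(· | γ)` is flipped; if `q = 0`, nothing changes. -/
def moveProb (γ : Inclusion P) (q : Bool) (γ' : Inclusion P) : ℝ :=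
  if q = true then ∑ j, (if flipAt γ j = γ' then D.selectProb γ j else 0)
  else (if γ' = γ then 1 else 0)

/-- `(γ^{(t)})_{t ≥ 0}` and `(Q^{(t)})_{t ≥ 1}`, random variables on the probability space `(Ω, μ)`,
are a run of the VC-wTGS algorithm with subset size `S`: `γ^{(0)}` is drawn from the prior, and at
iteration `t = 1, 2, …` the variable `Q^{(t)}` is drawn independently of the past and then
`γ^{(t)}` is produced from `γ^{(t-1)}` and `Q^{(t)}`. The field `path_law` is the resulting joint
law of the first `T` iterations. The variable `Q 0` plays no role. -/
structure IsVCwTGSRun (S : ℝ) {Ω : Type*} [MeasurableSpace Ω] (μ : Measure Ω)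
    (γ : ℕ → Ω → Inclusion P) (Q : ℕ → Ω → Bool) : Prop where
  measurable_γ : ∀ t, Measurable (γ t)
  measurable_Q : ∀ t, Measurable (Q t)
  path_law : ∀ (T : ℕ) (g : ℕ → Inclusion P) (q : ℕ → Bool),
    μ.real {ω | γ 0 ω = g 0 ∧ ∀ t ∈ Finset.Icc 1 T, Q t ω = q t ∧ γ t ω = g t} =
      D.prior (g 0) *
        ∏ t ∈ Finset.Icc 1 T, D.qProb S t (q t) * D.moveProb (g (t - 1)) (q t) (g t)

/-- The unnormalized weight `ρ̃^{(t)}` computed at an iteration that ends in `γ^{(t)} = γ` with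
`Q^{(t)} = q`. -/
def rawWeight (γ : Inclusion P) (q : Bool) : ℝ :=
  if q = true then (D.phi γ)⁻¹ else 1

/-- The normalized weight `ρ^{(t)} = ρ̃^{(t)} Q^{(t)} / ∑_{s=1}^T ρ̃^{(s)} Q^{(s)}` of the
trajectory `(g, q)`. -/
def weight (g : ℕ → Inclusion P) (q : ℕ → Bool) (T t : ℕ) : ℝ :=
  (D.rawWeight (g t) (q t) * if q t = true then 1 else 0) /
    ∑ s ∈ Finset.Icc 1 T, D.rawWeight (g s) (q s) * if q s = true then 1 else 0

/-- The Rao-Blackwellized estimator `E_{i,T} = ∑_{t=1}^T ρ^{(t)} p(γ_i^{(t)} = 1 | γ_{-i}^{(t)}, 𝒟)`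
evaluated on the trajectory `(g, q)`. -/
def estimator (i : Fin P) (T : ℕ) (g : ℕ → Inclusion P) (q : ℕ → Bool) : ℝ :=
  ∑ t ∈ Finset.Icc 1 T, D.weight g q T t * D.condPosterior (g t) i true

end BVSProblem

end

/-!
Call an iteration active when `Q = 1`, and let `K` be the transition matrix of the flips made in
active iterations. Since `p(γ_j | γ_{-j}, 𝒟)` is a quotient of posterior masses, `K` is reversible
for the weights `posterior γ * phi γ` (`posterior_mul_phi_mul_selectProb`), and every flip has
positive probability because the posterior charges every `γ` (`posterior_pos`). With
`score γ = (p(γ_i = 1 | γ_{-i}, 𝒟) - PIP i) / phi γ`, the error of the estimator is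

  `(∑ over active t of score γ^{(t)}) / (∑ over active t of 1 / phi γ^{(t)})`,

and `score` has stationary mean zero (`sum_posterior_mul_condPosterior`). The kernel of `1 - K`
consists of the constants by the maximum principle, so the Poisson equation `u - K u = score` has
a solution (`exists_flipGenerator_eq`). With `v = K u` the numerator telescopes to a sum of bounded
martingale differences plus a bounded term (`scoreIncrement`), whether or not the individual
iterations are active. The number of active iterations minus its mean is another such sum
(`activeIncrement`).

Multiplying the error, which is at most `1` in absolute value, by the expected number `T S / P` of
active iterations therefore gives at most a combination of two martingales and a constant
(`mul_abs_estimator_sub_PIP_le`). For sums of bounded martingale differences on a finite state space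
the second moment is `O(T)` (`integral_sum_sq_le`) and the strong law holds (`ae_tendsto_sum_div`).
This yields the almost sure convergence and the mean squared error bound `B / ((S / P)² T)` with
`B` depending only on the dataset, the hyperparameters and `i` (`exists_mse_bound`). For
`T ≥ exp B` the factor `log T` dominates `B`, and `max phi / min phi` is at least `1`, so the
asserted bound holds with the absolute constant `1`.
-/

/-! ### Sums of martingale differences on a finite state space -/

section FiniteState

variable {Ω : Type*} [MeasurableSpace Ω] {μ : Measure Ω} [IsProbabilityMeasure μ]

theorem integrable_comp_of_finite {α : Type*} [Finite α] [MeasurableSpace α]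
    [MeasurableSingletonClass α] {H : Ω → α} (hH : Measurable H) (F : α → ℝ) :
    Integrable (fun ω => F (H ω)) μ := by
  have hF : Measurable F := measurable_of_finite F
  obtain ⟨c, hc⟩ := (Set.finite_range fun a => ‖F a‖).bddAbove
  exact Integrable.of_bound (hF.comp hH).aestronglyMeasurable c
    (ae_of_all _ fun ω => hc ⟨H ω, rfl⟩)

theorem integral_comp_eq_sum {α : Type*} [Fintype α] [MeasurableSpace α]
    [MeasurableSingletonClass α] {H : Ω → α} (hH : Measurable H) (F : α → ℝ) :
    ∫ ω, F (H ω) ∂μ = ∑ a, μ.real (H ⁻¹' {a}) * F a := by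
  have hF : Measurable F := measurable_of_finite F
  have := Measure.isProbabilityMeasure_map (μ := μ) hH.aemeasurable
  rw [← integral_map (φ := H) hH.aemeasurable hF.aestronglyMeasurable,
    integral_fintype Integrable.of_finite]
  refine Finset.sum_congr rfl fun a _ => ?_
  rw [smul_eq_mul, map_measureReal_apply hH (measurableSet_singleton a)]

variable {E : Type*} [Fintype E] [MeasurableSpace E] [MeasurableSingletonClass E]

/-- The process `X` takes its values in `E` and is a (time-inhomogeneous) Markov chain with
transition matrices `k t`, expressed through the probabilities of finite trajectories. -/
def HasTransitions (μ : Measure Ω) (X : ℕ → Ω → E) (k : ℕ → E → E → ℝ) : Prop :=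
  ∀ (T : ℕ) (x : ℕ → E), μ.real {ω | ∀ t ≤ T + 1, X t ω = x t} =
    μ.real {ω | ∀ t ≤ T, X t ω = x t} * k T (x T) (x (T + 1))

variable {X : ℕ → Ω → E} {k : ℕ → E → E → ℝ}

omit [Fintype E] [MeasurableSingletonClass E] in
theorem measurable_history (hX : ∀ t, Measurable (X t)) (T : ℕ) :
    Measurable fun ω (t : Fin (T + 1)) => X t ω :=
  measurable_pi_lambda _ fun t => hX t

/-- A function of the current transition whose conditional mean vanishes in every state is
orthogonal to every function of the past. -/
theorem integral_history_mul_eq_zero (hX : ∀ t, Measurable (X t)) (hk : HasTransitions μ X k)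
    (T : ℕ) (Φ : (Fin (T + 1) → E) → ℝ) {d : E → E → ℝ} (hd : ∀ e, ∑ e', k T e e' * d e e' = 0) :
    ∫ ω, Φ (fun t => X t ω) * d (X T ω) (X (T + 1) ω) ∂μ = 0 := by
  classical
  have hH : Measurable fun ω => ((fun t : Fin (T + 1) => X t ω), X (T + 1) ω) :=
    (measurable_history hX T).prodMk (hX (T + 1))
  refine (integral_comp_eq_sum hH fun p => Φ p.1 * d (p.1 (Fin.last T)) p.2).trans ?_
  rw [Fintype.sum_prod_type]
  refine Finset.sum_eq_zero fun h _ => ?_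
  have key : ∀ e : E,
      μ.real ((fun ω => ((fun t : Fin (T + 1) => X t ω), X (T + 1) ω)) ⁻¹' {(h, e)}) =
        μ.real {ω | ∀ t : Fin (T + 1), X t ω = h t} * k T (h (Fin.last T)) e := by
    intro e
    have := hk T fun t => if ht : t < T + 1 then h ⟨t, ht⟩ else e
    simp only [lt_add_iff_pos_right, zero_lt_one, dif_pos, lt_irrefl, dif_neg,
      not_false_eq_true] at this
    convert this using 2
    · ext ω
      simp only [Set.mem_preimage, Set.mem_singleton_iff, Prod.mk.injEq, funext_iff,
        Set.mem_ofPred_eq]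
      constructor
      · rintro ⟨h1, h2⟩ t ht
        rcases Nat.lt_or_ge t (T + 1) with h3 | h3
        · rw [dif_pos h3]; exact h1 ⟨t, h3⟩
        · obtain rfl : t = T + 1 := by omega
          rw [dif_neg (by omega)]; exact h2
      · intro h1
        refine ⟨fun t => ?_, ?_⟩
        · have := h1 t (by omega)
          rwa [dif_pos t.2] at this
        · have := h1 (T + 1) le_rfl
          rwa [dif_neg (by omega)] at this
    · congr 1
      ext ω
      simp only [Set.mem_ofPred_eq]
      constructor
      · intro h1 t ht
        rw [dif_pos (by omega)]; exact h1 ⟨t, by omega⟩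
      · intro h1 t
        have := h1 t (by omega)
        rwa [dif_pos t.2] at this
    · rfl
  simp_rw [key]
  calc _ = μ.real {ω | ∀ t : Fin (T + 1), X t ω = h t} * Φ h *
        ∑ e, k T (h (Fin.last T)) e * d (h (Fin.last T)) e := by
        rw [Finset.mul_sum]
        exact Finset.sum_congr rfl fun e _ => by ring
    _ = 0 := by rw [hd, mul_zero]

theorem integrable_sum_sq (hX : ∀ t, Measurable (X t)) (d : ℕ → E → E → ℝ) (T : ℕ) :
    Integrable (fun ω => (∑ t ∈ Finset.range T, d t (X t ω) (X (t + 1) ω)) ^ 2) μ := by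
  convert integrable_comp_of_finite (μ := μ) (measurable_history hX T)
    (fun h => (∑ t : Fin T, d t (h t.castSucc) (h t.succ)) ^ 2) using 3
  rw [Finset.sum_range]
  rfl

/-- The increments are orthogonal, so the second moment of their sum grows at most linearly. -/
theorem integral_sum_sq_le (hX : ∀ t, Measurable (X t)) (hk : HasTransitions μ X k)
    {d : ℕ → E → E → ℝ} (hd : ∀ t e, ∑ e', k t e e' * d t e e' = 0) {c : ℝ}
    (hc : ∀ t e e', |d t e e'| ≤ c) (T : ℕ) :
    ∫ ω, (∑ t ∈ Finset.range T, d t (X t ω) (X (t + 1) ω)) ^ 2 ∂μ ≤ c ^ 2 * T := by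
  induction T with
  | zero => simp
  | succ T ih =>
    have hH := measurable_history hX T
    let Φ : (Fin (T + 1) → E) → ℝ := fun h => ∑ t : Fin T, d t (h t.castSucc) (h t.succ)
    have hΦ : ∀ ω, ∑ t ∈ Finset.range T, d t (X t ω) (X (t + 1) ω) =
        Φ fun t : Fin (T + 1) => X t ω := fun ω => by
      rw [Finset.sum_range]; rfl
    have h0 := integral_history_mul_eq_zero hX hk T Φ (hd T)
    have hI1 := integrable_sum_sq (μ := μ) hX d T
    have hI2 : Integrable (fun ω => Φ (fun t : Fin (T + 1) => X t ω) *
        d T (X T ω) (X (T + 1) ω)) μ :=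
      integrable_comp_of_finite (hH.prodMk (hX (T + 1)))
        fun p => Φ p.1 * d T (p.1 (Fin.last T)) p.2
    have hI3 : Integrable (fun ω => d T (X T ω) (X (T + 1) ω) ^ 2) μ :=
      integrable_comp_of_finite ((hX T).prodMk (hX (T + 1))) fun p => d T p.1 p.2 ^ 2
    have h3 : ∫ ω, d T (X T ω) (X (T + 1) ω) ^ 2 ∂μ ≤ c ^ 2 := by
      calc _ ≤ ∫ _, c ^ 2 ∂μ := integral_mono hI3 (integrable_const _) fun ω =>
            sq_le_sq' (neg_le_of_abs_le (hc _ _ _)) (le_of_abs_le (hc _ _ _))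
        _ = c ^ 2 := by simp
    have heq : ∀ ω, (∑ t ∈ Finset.range (T + 1), d t (X t ω) (X (t + 1) ω)) ^ 2 =
        (∑ t ∈ Finset.range T, d t (X t ω) (X (t + 1) ω)) ^ 2 +
        2 * (Φ (fun t : Fin (T + 1) => X t ω) * d T (X T ω) (X (T + 1) ω)) +
        d T (X T ω) (X (T + 1) ω) ^ 2 := fun ω => by
      rw [Finset.sum_range_succ, ← hΦ]; ring
    simp_rw [heq]
    have h1 := integral_add (hI1.add (hI2.const_mul 2)) hI3
    have h2 := integral_add hI1 (hI2.const_mul 2)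
    simp only [Pi.add_apply] at h1
    rw [h1, h2, integral_const_mul, h0]
    push_cast
    linarith

/-- A sequence with bounded increments is `o(n)` as soon as it is along the squares. -/
theorem tendsto_div_of_sq_subseq {a : ℕ → ℝ} {c : ℝ} (ha : ∀ n, |a (n + 1) - a n| ≤ c)
    (h : Tendsto (fun m : ℕ => a (m ^ 2) / (m : ℝ) ^ 2) atTop (𝓝 0)) :
    Tendsto (fun n : ℕ => a n / n) atTop (𝓝 0) := by
  have hc : 0 ≤ c := (abs_nonneg _).trans (ha 0)
  have hstep : ∀ n r : ℕ, |a (n + r)| ≤ |a n| + c * r := by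
    intro n r
    induction r with
    | zero => simp
    | succ r ih =>
      have h1 := ha (n + r)
      have h2 : |a (n + r + 1)| ≤ |a (n + r + 1) - a (n + r)| + |a (n + r)| := by
        simpa using abs_add_le (a (n + r + 1) - a (n + r)) (a (n + r))
      rw [← add_assoc]; push_cast; linarith
  have hsqrt : Tendsto Nat.sqrt atTop atTop :=
    tendsto_atTop.2 fun b => (eventually_ge_atTop (b * b)).mono fun n hn => Nat.le_sqrt.2 hn
  have h1 : Tendsto (fun n : ℕ => |a (n.sqrt ^ 2) / (n.sqrt : ℝ) ^ 2| + 2 * c / (n.sqrt : ℝ))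
      atTop (𝓝 0) := by
    have h2 := (h.comp hsqrt).abs
    have h3 : Tendsto (fun n : ℕ => 2 * c / (n.sqrt : ℝ)) atTop (𝓝 0) :=
      (tendsto_const_div_atTop_nhds_zero_nat (2 * c)).comp hsqrt
    simpa using h2.add h3
  refine squeeze_zero_norm' ?_ h1
  filter_upwards [eventually_ge_atTop 1] with n hn
  have hm : 0 < n.sqrt := Nat.sqrt_pos.2 hn
  obtain ⟨r, hr⟩ := Nat.exists_eq_add_of_le (Nat.sqrt_le' n)
  have hr2 : r ≤ 2 * n.sqrt := by
    have := Nat.sqrt_le_add n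
    nlinarith
  have hm' : (0 : ℝ) < n.sqrt := by exact_mod_cast hm
  have hle : ((n.sqrt : ℝ)) ^ 2 ≤ n := by exact_mod_cast Nat.sqrt_le' n
  have h4 : |a n| ≤ |a (n.sqrt ^ 2)| + c * (2 * n.sqrt) := by
    calc |a n| = |a (n.sqrt ^ 2 + r)| := by rw [← hr]
      _ ≤ |a (n.sqrt ^ 2)| + c * r := hstep _ _
      _ ≤ _ := by
        have : (r : ℝ) ≤ 2 * n.sqrt := by exact_mod_cast hr2
        gcongr
  rw [Real.norm_eq_abs, abs_div, Nat.abs_cast, abs_div, abs_of_pos (pow_pos hm' 2)]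
  calc |a n| / n ≤ (|a (n.sqrt ^ 2)| + c * (2 * n.sqrt)) / (n.sqrt : ℝ) ^ 2 := by
        gcongr
    _ = _ := by field_simp

/-- Strong law of large numbers: second moments are summable along the squares, and the bounded
increments control the sum in between. -/
theorem ae_tendsto_sum_div (hX : ∀ t, Measurable (X t)) (hk : HasTransitions μ X k)
    {d : ℕ → E → E → ℝ} (hd : ∀ t e, ∑ e', k t e e' * d t e e' = 0) {c : ℝ}
    (hc : ∀ t e e', |d t e e'| ≤ c) :
    ∀ᵐ ω ∂μ, Tendsto
      (fun T : ℕ => (∑ t ∈ Finset.range T, d t (X t ω) (X (t + 1) ω)) / T) atTop (𝓝 0) := by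
  let Z : ℕ → Ω → ℝ := fun T ω => ∑ t ∈ Finset.range T, d t (X t ω) (X (t + 1) ω)
  let F : ℕ → Ω → ℝ := fun m ω => (Z ((m + 1) ^ 2) ω / ((m + 1 : ℕ) : ℝ) ^ 2) ^ 2
  have hFint : ∀ m, Integrable (F m) μ := fun m => by
    simpa only [F, div_pow] using (integrable_sum_sq (μ := μ) hX d _).div_const _
  have hF : ∀ m, ∫ ω, ‖F m ω‖ ∂μ ≤ c ^ 2 * (1 / ((m + 1 : ℕ) : ℝ) ^ 2) := fun m => by
    have h1 : ∀ ω, ‖F m ω‖ = Z ((m + 1) ^ 2) ω ^ 2 / (((m + 1 : ℕ) : ℝ) ^ 2) ^ 2 := fun ω => by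
      rw [Real.norm_of_nonneg (sq_nonneg _)]; exact div_pow _ _ _
    simp_rw [h1]
    rw [integral_div]
    calc _ ≤ c ^ 2 * (((m + 1) ^ 2 : ℕ) : ℝ) / (((m + 1 : ℕ) : ℝ) ^ 2) ^ 2 := by
          gcongr; exact integral_sum_sq_le hX hk hd hc _
      _ = _ := by push_cast; field_simp
  have hsum : Summable fun m => ∫ ω, ‖F m ω‖ ∂μ :=
    Summable.of_nonneg_of_le (fun m => integral_nonneg fun ω => norm_nonneg _) hF
      (((summable_nat_add_iff 1).2 (Real.summable_one_div_nat_pow.2 one_lt_two)).mul_left _)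
  have hae : ∀ᵐ ω ∂μ, Tendsto (fun m => F m ω) atTop (𝓝 0) := by
    have hne : ∫⁻ ω, ∑' m, ‖F m ω‖ₑ ∂μ ≠ ⊤ := by
      rw [lintegral_tsum fun m => (hFint m).1.enorm]
      simp_rw [← fun m => ofReal_integral_norm_eq_lintegral_enorm (hFint m)]
      exact hsum.tsum_ofReal_ne_top
    filter_upwards [ae_lt_top' (AEMeasurable.tsum fun m => (hFint m).1.enorm) hne]
      with ω hω
    have h0 := ENNReal.tendsto_atTop_zero_of_tsum_ne_top hω.ne
    exact tendsto_zero_iff_enorm_tendsto_zero.2 h0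
  filter_upwards [hae] with ω hω
  refine tendsto_div_of_sq_subseq (a := fun T => Z T ω) (c := c) (fun n => ?_) ?_
  · simp only [Z, Finset.sum_range_succ, add_sub_cancel_left]
    exact hc _ _ _
  · refine (tendsto_add_atTop_iff_nat 1).1 ?_
    rw [tendsto_zero_iff_abs_tendsto_zero]
    have := hω.sqrt
    simpa [F, Real.sqrt_sq_eq_abs, Function.comp_def] using this

end FiniteState

/-! ### Positivity of the posterior -/

theorem gaussianPDFReal_le (m s x : ℝ) :
    gaussianPDFReal m s.toNNReal x ≤ (√(2 * Real.pi * s.toNNReal))⁻¹ := by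
  rw [gaussianPDFReal]
  refine mul_le_of_le_one_right (by positivity) (Real.exp_le_one_iff.2 ?_)
  rw [neg_div]
  exact neg_nonpos.2 (by positivity)

/-- The substitution `s ↦ s⁻¹` turns the integrand into that of the Gamma function. -/
theorem integrableOn_rpow_mul_exp_neg_div {a b : ℝ} (ha : 0 < a) (hb : 0 < b) :
    IntegrableOn (fun s : ℝ => s ^ (-a - 1) * Real.exp (-b / s)) (Set.Ioi 0) := by
  have h := integrableOn_rpow_mul_exp_neg_mul_rpow (s := a - 1) (by linarith) one_pos hb
  refine ((integrableOn_Ioi_comp_rpow_iff' _ (p := -1) (by norm_num)).2 h).congr_fun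
    (fun s (hs : 0 < s) => ?_) measurableSet_Ioi
  simp only [smul_eq_mul, Real.rpow_one]
  rw [← mul_assoc, ← Real.rpow_mul hs.le, ← Real.rpow_add hs, Real.rpow_neg_one]
  ring_nf

namespace BVSProblem

variable {N P : ℕ} (D : BVSProblem N P)

theorem prior_pos (γ : Inclusion P) : 0 < D.prior γ :=
  Finset.prod_pos fun j _ => by
    split_ifs
    exacts [D.h_pos, sub_pos.2 D.h_lt_one]

theorem likelihood_pos (γ : Inclusion P) {s : ℝ} (hs : 0 < s) (β) :
    0 < D.likelihood γ s β :=
  Finset.prod_pos fun _ _ => gaussianPDFReal_pos _ _ _ (by simpa using hs)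

theorem coeffDensity_pos (γ : Inclusion P) {s : ℝ} (hs : 0 < s) (β) :
    0 < D.coeffDensity γ s β :=
  Finset.prod_pos fun _ _ => gaussianPDFReal_pos _ _ _
    (by simpa using mul_pos hs (inv_pos.2 D.τ_pos))

theorem likelihood_le (γ : Inclusion P) (s : ℝ) (β) :
    D.likelihood γ s β ≤ (√(2 * Real.pi * s.toNNReal))⁻¹ ^ N := by
  calc _ ≤ ∏ _n : Fin N, (√(2 * Real.pi * s.toNNReal))⁻¹ :=
        Finset.prod_le_prod (fun _ _ => gaussianPDFReal_nonneg _ _ _)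
          fun _ _ => gaussianPDFReal_le _ _ _
    _ = _ := by simp

theorem measurable_integrand (γ : Inclusion P) :
    Measurable fun p : ℝ × ({j : Fin P // γ j = true} → ℝ) =>
      D.likelihood γ p.1 p.2 * D.coeffDensity γ p.1 p.2 := by
  unfold likelihood coeffDensity gaussianPDFReal
  fun_prop

theorem integrable_coeffDensity (γ : Inclusion P) (s : ℝ) :
    Integrable (D.coeffDensity γ s) :=
  Integrable.fintype_prod fun _ => integrable_gaussianPDFReal _ _

theorem integral_coeffDensity (γ : Inclusion P) {s : ℝ} (hs : 0 < s) :
    ∫ β, D.coeffDensity γ s β = 1 := by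
  have hv : (s * D.τ⁻¹).toNNReal ≠ 0 := by simpa using mul_pos hs (inv_pos.2 D.τ_pos)
  simp only [coeffDensity]
  rw [integral_fintype_prod_volume_eq_prod]
  simp [integral_gaussianPDFReal_eq_one _ hv]

theorem integrable_likelihood_mul_coeffDensity (γ : Inclusion P) {s : ℝ} (hs : 0 < s) :
    Integrable fun β => D.likelihood γ s β * D.coeffDensity γ s β := by
  refine ((D.integrable_coeffDensity γ s).const_mul ((√(2 * Real.pi * s.toNNReal))⁻¹ ^ N)).mono'
    ((D.measurable_integrand γ).comp measurable_prodMk_left).aestronglyMeasurable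
    (ae_of_all _ fun β => ?_)
  rw [Real.norm_of_nonneg (mul_pos (D.likelihood_pos γ hs β) (D.coeffDensity_pos γ hs β)).le]
  exact mul_le_mul_of_nonneg_right (D.likelihood_le γ s β) (D.coeffDensity_pos γ hs β).le

theorem integral_likelihood_mul_coeffDensity_pos (γ : Inclusion P) {s : ℝ} (hs : 0 < s) :
    0 < ∫ β, D.likelihood γ s β * D.coeffDensity γ s β := by
  have hpos := fun β => mul_pos (D.likelihood_pos γ hs β) (D.coeffDensity_pos γ hs β)
  rw [integral_pos_iff_support_of_nonneg (fun β => (hpos β).le)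
    (D.integrable_likelihood_mul_coeffDensity γ hs)]
  rw [Function.support_eq_univ fun β => (hpos β).ne']
  exact isOpen_univ.measure_pos _ Set.univ_nonempty

theorem integral_likelihood_mul_coeffDensity_le (γ : Inclusion P) {s : ℝ} (hs : 0 < s) :
    ∫ β, D.likelihood γ s β * D.coeffDensity γ s β ≤ (√(2 * Real.pi * s.toNNReal))⁻¹ ^ N := by
  calc _ ≤ ∫ β, (√(2 * Real.pi * s.toNNReal))⁻¹ ^ N * D.coeffDensity γ s β :=
        integral_mono (D.integrable_likelihood_mul_coeffDensity γ hs)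
          ((D.integrable_coeffDensity γ s).const_mul _) fun β =>
          mul_le_mul_of_nonneg_right (D.likelihood_le γ s β) (D.coeffDensity_pos γ hs β).le
    _ = _ := by rw [integral_const_mul, D.integral_coeffDensity γ hs, mul_one]

theorem invGammaDensity_pos {s : ℝ} (hs : 0 < s) :
    0 < invGammaDensity (D.ν₀ / 2) (D.ν₀ * D.lam₀ / 2) s := by
  have h1 := D.ν₀_pos
  have h2 := D.lam₀_pos
  have := Real.Gamma_pos_of_pos (half_pos h1)
  rw [invGammaDensity, if_pos hs]
  positivity

/-- Bounding the Gaussian likelihood by its maximum `(2πs)^(-N/2)` leaves an inverse-gamma integrand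
with shape `ν₀ / 2 + N / 2`. -/
theorem integrableOn_marginalLikelihood (γ : Inclusion P) :
    IntegrableOn (fun s => invGammaDensity (D.ν₀ / 2) (D.ν₀ * D.lam₀ / 2) s *
      ∫ β, D.likelihood γ s β * D.coeffDensity γ s β) (Set.Ioi 0) := by
  have h1 := D.ν₀_pos
  have h2 := D.lam₀_pos
  have hdom := (integrableOn_rpow_mul_exp_neg_div (a := D.ν₀ / 2 + N / 2)
    (b := D.ν₀ * D.lam₀ / 2) (by positivity) (by positivity)).const_mul
    ((D.ν₀ * D.lam₀ / 2) ^ (D.ν₀ / 2) / Real.Gamma (D.ν₀ / 2) * (√(2 * Real.pi))⁻¹ ^ N)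
  refine Integrable.mono' hdom ?_ ?_
  · refine AEStronglyMeasurable.mul ?_ ?_
    · unfold invGammaDensity
      exact (Measurable.ite measurableSet_Ioi (by fun_prop)
        measurable_const).aestronglyMeasurable
    · exact ((D.measurable_integrand γ).stronglyMeasurable.integral_prod_right
        (ν := volume)).aestronglyMeasurable
  · refine (ae_restrict_iff' measurableSet_Ioi).2 (ae_of_all _ fun s (hs : 0 < s) => ?_)
    rw [Real.norm_of_nonneg (mul_pos (D.invGammaDensity_pos hs)
      (D.integral_likelihood_mul_coeffDensity_pos γ hs)).le]
    refine (mul_le_mul_of_nonneg_left (D.integral_likelihood_mul_coeffDensity_le γ hs)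
      (D.invGammaDensity_pos hs).le).trans_eq ?_
    have h3 : (√(s : ℝ))⁻¹ ^ N = s ^ (-(N / 2 : ℝ)) := by
      rw [Real.sqrt_eq_rpow, ← Real.rpow_neg hs.le, ← Real.rpow_mul_natCast hs.le]
      congr 1; ring
    rw [invGammaDensity, if_pos hs, Real.coe_toNNReal _ hs.le, Real.sqrt_mul (by positivity),
      mul_inv, mul_pow, h3,
      show -(D.ν₀ / 2 + N / 2) - 1 = (-(D.ν₀ / 2) - 1) + -(N / 2 : ℝ) by ring, Real.rpow_add hs]
    ring

theorem marginalLikelihood_pos (γ : Inclusion P) : 0 < D.marginalLikelihood γ := by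
  have hpos := fun (s : ℝ) (hs : s ∈ Set.Ioi (0 : ℝ)) => mul_pos (D.invGammaDensity_pos hs)
      (D.integral_likelihood_mul_coeffDensity_pos γ hs)
  rw [marginalLikelihood, setIntegral_pos_iff_support_of_nonneg_ae
    ((ae_restrict_iff' measurableSet_Ioi).2 (ae_of_all _ fun s hs => (hpos s hs).le))
    (D.integrableOn_marginalLikelihood γ)]
  rw [Set.inter_eq_right.2 fun s hs => Function.mem_support.2 (hpos s hs).ne']
  simp

theorem posterior_pos (γ : Inclusion P) : 0 < D.posterior γ := by
  have h := fun γ' => mul_pos (D.prior_pos γ') (D.marginalLikelihood_pos γ')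
  exact div_pos (h γ) (Finset.sum_pos (fun γ' _ => h γ') Finset.univ_nonempty)

theorem sum_posterior : ∑ γ, D.posterior γ = 1 := by
  have h := fun γ' => mul_pos (D.prior_pos γ') (D.marginalLikelihood_pos γ')
  simp only [posterior]
  rw [← Finset.sum_div, div_self (Finset.sum_pos (fun γ' _ => h γ') Finset.univ_nonempty).ne']

end BVSProblem

/-! ### The flip chain and its Poisson equation -/

section Flip

variable {P : ℕ}

theorem flipAt_apply_self (γ : Inclusion P) (j : Fin P) : flipAt γ j j = !γ j := by
  simp [flipAt]

theorem flipAt_apply_of_ne (γ : Inclusion P) {j l : Fin P} (h : l ≠ j) :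
    flipAt γ j l = γ l := by
  simp [flipAt, h]

theorem update_flipAt (γ : Inclusion P) (j : Fin P) (b : Bool) :
    Function.update (flipAt γ j) j b = Function.update γ j b := by
  simp [flipAt]

theorem flipAt_flipAt (γ : Inclusion P) (j : Fin P) : flipAt (flipAt γ j) j = γ := by
  rw [flipAt, update_flipAt, flipAt_apply_self, Bool.not_not, Function.update_eq_self]

theorem sum_comp_flipAt (F : Inclusion P → ℝ) (j : Fin P) :
    ∑ γ, F (flipAt γ j) = ∑ γ, F γ :=
  Equiv.sum_comp (Function.Involutive.toPerm (flipAt · j) fun γ => flipAt_flipAt γ j) F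

/-- Flips connect all inclusion vectors: the target is reached by correcting one coordinate after
the other. -/
theorem eq_univ_of_flipAt_mem {A : Set (Inclusion P)} (hA : A.Nonempty)
    (h : ∀ γ ∈ A, ∀ j, flipAt γ j ∈ A) : A = Set.univ := by
  refine Set.eq_univ_of_forall fun γ' => ?_
  have key : ∀ s : Finset (Fin P), ∃ γ ∈ A, ∀ j ∈ s, γ j = γ' j := by
    intro s
    induction s using Finset.induction_on with
    | empty => exact ⟨hA.some, hA.some_mem, by simp⟩
    | insert j s hj ih =>
      obtain ⟨γ, hγ, hs⟩ := ih
      by_cases hjj : γ j = γ' j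
      · exact ⟨γ, hγ, by simpa [hjj] using hs⟩
      · refine ⟨flipAt γ j, h γ hγ j, fun l hl => ?_⟩
        rcases Finset.mem_insert.1 hl with rfl | hls
        · rw [flipAt_apply_self]
          cases h1 : γ l <;> cases h2 : γ' l <;> simp_all
        · rw [flipAt_apply_of_ne γ (by rintro rfl; exact hj hls)]
          exact hs l hls
  obtain ⟨γ, hγ, hs⟩ := key Finset.univ
  rwa [← funext fun j => hs j (Finset.mem_univ j)]

end Flip

namespace BVSProblem

variable {N P : ℕ} (D : BVSProblem N P)

theorem sum_posterior_update (γ : Inclusion P) (j : Fin P) :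
    ∑ c : Bool, D.posterior (Function.update γ j c) =
      D.posterior γ + D.posterior (flipAt γ j) := by
  rw [Fintype.sum_bool, flipAt]
  cases h : γ j
  · rw [add_comm, ← h, Function.update_eq_self, h]; rfl
  · rw [← h, Function.update_eq_self, h]; rfl

theorem condPosterior_eq (γ : Inclusion P) (j : Fin P) (b : Bool) :
    D.condPosterior γ j b = D.posterior (Function.update γ j b) /
      (D.posterior γ + D.posterior (flipAt γ j)) := by
  rw [condPosterior, sum_posterior_update]

theorem condPosterior_flipAt (γ : Inclusion P) (j : Fin P) (b : Bool) :
    D.condPosterior (flipAt γ j) j b = D.condPosterior γ j b := by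
  simp [condPosterior, update_flipAt]

theorem condPosterior_pos (γ : Inclusion P) (j : Fin P) (b : Bool) :
    0 < D.condPosterior γ j b :=
  div_pos (D.posterior_pos _) (Finset.sum_pos (fun _ _ => D.posterior_pos _) Finset.univ_nonempty)

theorem condPosterior_le_one (γ : Inclusion P) (j : Fin P) (b : Bool) :
    D.condPosterior γ j b ≤ 1 :=
  div_le_one_of_le₀ (Finset.single_le_sum (f := fun c => D.posterior (Function.update γ j c))
    (fun _ _ => (D.posterior_pos _).le) (Finset.mem_univ b))
    (Finset.sum_nonneg fun _ _ => (D.posterior_pos _).le)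

/-- The posterior mean of the conditional inclusion probability is the inclusion probability: this
is what makes the Rao-Blackwellized estimator consistent. -/
theorem sum_posterior_mul_condPosterior (i : Fin P) :
    ∑ γ, D.posterior γ * D.condPosterior γ i true = D.PIP i := by
  have hpair : ∀ γ : Inclusion P,
      D.posterior γ * D.condPosterior γ i true +
        D.posterior (flipAt γ i) * D.condPosterior (flipAt γ i) i true =
      (if γ i = true then D.posterior γ else 0) +
        (if flipAt γ i i = true then D.posterior (flipAt γ i) else 0) := by
    intro γ
    have h0 : D.posterior γ + D.posterior (flipAt γ i) ≠ 0 :=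
      (add_pos (D.posterior_pos _) (D.posterior_pos _)).ne'
    rw [condPosterior_flipAt, ← add_mul, condPosterior_eq, mul_div_cancel₀ _ h0,
      flipAt_apply_self, flipAt]
    cases h : γ i
    · simp
    · rw [← h, Function.update_eq_self, h]; simp
  have hsum := Finset.sum_congr (rfl : (Finset.univ : Finset (Inclusion P)) = Finset.univ)
    fun γ _ => hpair γ
  rw [Finset.sum_add_distrib, Finset.sum_add_distrib,
    sum_comp_flipAt (fun γ => D.posterior γ * D.condPosterior γ i true) i,
    sum_comp_flipAt (fun γ => if γ i = true then D.posterior γ else 0) i] at hsum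
  rw [PIP, Finset.sum_filter]
  linarith

theorem PIP_nonneg (i : Fin P) : 0 ≤ D.PIP i :=
  Finset.sum_nonneg fun _ _ => (D.posterior_pos _).le

theorem PIP_le_one (i : Fin P) : D.PIP i ≤ 1 :=
  (Finset.sum_le_univ_sum_of_nonneg fun γ => (D.posterior_pos γ).le).trans_eq D.sum_posterior

theorem phi_pos (i : Fin P) (γ : Inclusion P) : 0 < D.phi γ :=
  Finset.sum_pos (fun _ _ => div_pos (mul_pos one_half_pos (D.condPosterior_pos _ _ _))
    (D.condPosterior_pos _ _ _)) ⟨i, Finset.mem_univ i⟩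

theorem selectProb_pos (γ : Inclusion P) (j : Fin P) : 0 < D.selectProb γ j :=
  mul_pos (inv_pos.2 (D.phi_pos j γ)) (div_pos (mul_pos one_half_pos (D.condPosterior_pos _ _ _))
    (D.condPosterior_pos _ _ _))

theorem sum_selectProb (i : Fin P) (γ : Inclusion P) : ∑ j, D.selectProb γ j = 1 := by
  simp only [selectProb]
  rw [← Finset.mul_sum]
  exact inv_mul_cancel₀ (D.phi_pos i γ).ne'

/-- Stationary flow from `γ` to `flipAt γ j`: the right-hand side is unchanged when `γ` and
`flipAt γ j` are exchanged, so the flip chain is reversible for the weights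
`posterior γ * phi γ`. -/
theorem posterior_mul_phi_mul_selectProb (γ : Inclusion P) (j : Fin P) :
    D.posterior γ * D.phi γ * D.selectProb γ j =
      1 / 2 * D.weightEta γ j * (D.posterior γ + D.posterior (flipAt γ j)) := by
  have h1 := (D.phi_pos j γ).ne'
  have h2 := (D.posterior_pos γ).ne'
  have h3 : D.posterior γ + D.posterior (flipAt γ j) ≠ 0 :=
    (add_pos (D.posterior_pos _) (D.posterior_pos _)).ne'
  rw [selectProb, D.condPosterior_eq γ j (γ j), Function.update_eq_self]
  field_simp

/-- The generator `u ↦ u - K u` of the flip chain, where `K` is the transition operator of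
the moves made when `Q = 1`. -/
noncomputable def flipGenerator : (Inclusion P → ℝ) →ₗ[ℝ] (Inclusion P → ℝ) where
  toFun u γ := u γ - ∑ j, D.selectProb γ j * u (flipAt γ j)
  map_add' u v := by
    ext γ; simp only [Pi.add_apply, mul_add, Finset.sum_add_distrib]; ring
  map_smul' c u := by
    ext γ
    simp only [Pi.smul_apply, smul_eq_mul, RingHom.id_apply, mul_sub, Finset.mul_sum]
    congr 1
    exact Finset.sum_congr rfl fun j _ => by ring

theorem flipGenerator_apply (u : Inclusion P → ℝ) (γ : Inclusion P) :
    D.flipGenerator u γ = u γ - ∑ j, D.selectProb γ j * u (flipAt γ j) := rfl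

theorem flipGenerator_apply_eq_sum (i : Fin P) (u : Inclusion P → ℝ) (γ : Inclusion P) :
    D.flipGenerator u γ = ∑ j, D.selectProb γ j * (u γ - u (flipAt γ j)) := by
  simp only [mul_sub, Finset.sum_sub_distrib]
  rw [← Finset.sum_mul, D.sum_selectProb i, one_mul, flipGenerator_apply]

theorem sum_posterior_mul_phi_mul_flipGenerator (i : Fin P) (u : Inclusion P → ℝ) :
    ∑ γ, D.posterior γ * D.phi γ * D.flipGenerator u γ = 0 := by
  simp only [D.flipGenerator_apply_eq_sum i, Finset.mul_sum]
  rw [Finset.sum_comm]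
  refine Finset.sum_eq_zero fun j _ => ?_
  let F : Inclusion P → ℝ := fun γ =>
    1 / 2 * D.weightEta γ j * (D.posterior γ + D.posterior (flipAt γ j)) * u γ
  calc _ = ∑ γ, (F γ - F (flipAt γ j)) := Finset.sum_congr rfl fun γ _ => by
        simp only [F, weightEta, condPosterior_flipAt, flipAt_flipAt]
        rw [← mul_assoc, D.posterior_mul_phi_mul_selectProb, weightEta]
        ring
    _ = 0 := by rw [Finset.sum_sub_distrib, sum_comp_flipAt, sub_self]

/-- Maximum principle: the set where a harmonic function is maximal is closed under flips. -/
theorem eq_const_of_flipGenerator_eq_zero (i : Fin P) {u : Inclusion P → ℝ}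
    (hu : D.flipGenerator u = 0) : ∃ c : ℝ, u = fun _ => c := by
  obtain ⟨γ₀, hγ₀⟩ := Finite.exists_max u
  refine ⟨u γ₀, ?_⟩
  have hA : {γ | u γ = u γ₀} = Set.univ := by
    refine eq_univ_of_flipAt_mem ⟨γ₀, rfl⟩ fun γ (hγ : u γ = u γ₀) j => ?_
    have h0 := congrFun hu γ
    rw [D.flipGenerator_apply_eq_sum i, Pi.zero_apply, Finset.sum_eq_zero_iff_of_nonneg
      fun l _ => mul_nonneg (D.selectProb_pos γ l).le (by rw [hγ]; exact sub_nonneg.2 (hγ₀ _))]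
      at h0
    have h1 := (mul_eq_zero.1 (h0 j (Finset.mem_univ j))).resolve_left (D.selectProb_pos γ j).ne'
    change u (flipAt γ j) = u γ₀
    linarith
  funext γ
  have : γ ∈ {γ | u γ = u γ₀} := hA ▸ Set.mem_univ γ
  exact this

/-- Poisson equation. The range of the generator lies in the hyperplane of the functions with
stationary mean zero, and has the same dimension because the kernel is one-dimensional. -/
theorem exists_flipGenerator_eq (i : Fin P) {g : Inclusion P → ℝ}
    (hg : ∑ γ, D.posterior γ * D.phi γ * g γ = 0) : ∃ u, D.flipGenerator u = g := by
  let ℓ : (Inclusion P → ℝ) →ₗ[ℝ] ℝ :=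
    ∑ γ, (D.posterior γ * D.phi γ) • LinearMap.proj (R := ℝ) (φ := fun _ => ℝ) γ
  have hℓ : ∀ u, ℓ u = ∑ γ, D.posterior γ * D.phi γ * u γ := fun u => by
    simp [ℓ, LinearMap.sum_apply]
  have hle : LinearMap.range D.flipGenerator ≤ LinearMap.ker ℓ := by
    rintro _ ⟨u, rfl⟩
    rw [LinearMap.mem_ker, hℓ, D.sum_posterior_mul_phi_mul_flipGenerator i]
  have hker : Module.finrank ℝ (LinearMap.ker D.flipGenerator) ≤ 1 := by
    have : LinearMap.ker D.flipGenerator ≤ Submodule.span ℝ {fun _ : Inclusion P => (1 : ℝ)} := by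
      intro u hu
      obtain ⟨c, rfl⟩ := D.eq_const_of_flipGenerator_eq_zero i (LinearMap.mem_ker.1 hu)
      exact Submodule.mem_span_singleton.2 ⟨c, by ext; simp⟩
    exact (Submodule.finrank_mono this).trans 
      (finrank_span_singleton fun h => one_ne_zero (congrFun h default)).le
  have hsurj : LinearMap.range ℓ = ⊤ := by
    refine LinearMap.range_eq_top.2 (LinearMap.surjective_iff_ne_zero.2 fun h => ?_)
    have h1 : ℓ (fun _ => 1) = 0 := by rw [h]; rfl
    rw [hℓ] at h1
    exact (Finset.sum_pos (fun γ _ => mul_pos (mul_pos (D.posterior_pos γ) (D.phi_pos i γ))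
      one_pos) Finset.univ_nonempty).ne' h1
  have h1 := LinearMap.finrank_range_add_finrank_ker D.flipGenerator
  have h2 := LinearMap.finrank_range_add_finrank_ker ℓ
  rw [hsurj, finrank_top, Module.finrank_self] at h2
  have heq := Submodule.eq_of_le_of_finrank_le hle (by omega)
  have : g ∈ LinearMap.range D.flipGenerator := by
    rw [heq, LinearMap.mem_ker, hℓ]; exact hg
  exact this

/-- The contribution of an active iteration that ends in `γ` to the numerator of
`estimator - PIP`. -/
noncomputable def score (i : Fin P) (γ : Inclusion P) : ℝ :=
  (D.phi γ)⁻¹ * (D.condPosterior γ i true - D.PIP i)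

/-- `v = K u` for the solution `u` of the Poisson equation `u - K u = score`. -/
theorem exists_corrector (i : Fin P) : ∃ v : Inclusion P → ℝ, ∀ γ,
    ∑ j, D.selectProb γ j * (D.score i (flipAt γ j) + v (flipAt γ j) - v γ) = 0 := by
  obtain ⟨u, hu⟩ := D.exists_flipGenerator_eq i (g := D.score i) (by
    have : ∀ γ, D.posterior γ * D.phi γ * D.score i γ =
        D.posterior γ * D.condPosterior γ i true - D.posterior γ * D.PIP i := fun γ => by
      have := (D.phi_pos i γ).ne'
      rw [score]; field_simp
    simp_rw [this]
    rw [Finset.sum_sub_distrib, D.sum_posterior_mul_condPosterior, ← Finset.sum_mul,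
      D.sum_posterior, one_mul, sub_self])
  have hv : ∀ γ, D.score i γ + (u γ - D.score i γ) = u γ := fun γ => by ring
  refine ⟨fun γ => u γ - D.score i γ, fun γ => ?_⟩
  simp only [hv, mul_sub, Finset.sum_sub_distrib, ← Finset.sum_mul, D.sum_selectProb i, one_mul]
  have := congrFun hu γ
  rw [flipGenerator_apply] at this
  linarith

end BVSProblem

/-! ### The estimator along a trajectory and a run -/

theorem sum_Icc_one_eq_sum_range (f : ℕ → ℝ) (T : ℕ) :
    ∑ t ∈ Finset.Icc 1 T, f t = ∑ t ∈ Finset.range T, f (t + 1) := by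
  induction T with
  | zero => simp
  | succ T ih => rw [Finset.sum_Icc_succ_top (by omega), ih, Finset.sum_range_succ]

namespace BVSProblem

variable {N P : ℕ} (D : BVSProblem N P)

section Trajectory

variable (i : Fin P) (T : ℕ) (g : ℕ → Inclusion P) (q : ℕ → Bool)

theorem rawWeight_mul_indicator (γ : Inclusion P) (b : Bool) :
    (D.rawWeight γ b * if b = true then 1 else 0) = if b = true then (D.phi γ)⁻¹ else 0 := by
  cases b <;> simp [rawWeight]

theorem abs_estimator_sub_PIP_le_one : |D.estimator i T g q - D.PIP i| ≤ 1 := by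
  have hw : ∀ t, 0 ≤ if q t = true then (D.phi (g t))⁻¹ else 0 := fun t => by
    have := (D.phi_pos i (g t)).le
    split_ifs <;> positivity
  have h0 : 0 ≤ D.estimator i T g q := by
    refine Finset.sum_nonneg fun t _ => mul_nonneg ?_ (D.condPosterior_pos _ _ _).le
    simp only [weight, rawWeight_mul_indicator]
    exact div_nonneg (hw t) (Finset.sum_nonneg fun s _ => hw s)
  have h1 : D.estimator i T g q ≤ 1 := by
    calc _ ≤ ∑ t ∈ Finset.Icc 1 T, D.weight g q T t := by
          refine Finset.sum_le_sum fun t _ =>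
            mul_le_of_le_one_right ?_ (D.condPosterior_le_one _ _ _)
          simp only [weight, rawWeight_mul_indicator]
          exact div_nonneg (hw t) (Finset.sum_nonneg fun s _ => hw s)
      _ ≤ 1 := by
          simp only [weight]
          rw [← Finset.sum_div]
          exact div_self_le_one _
  have h2 := D.PIP_nonneg i
  have h3 := D.PIP_le_one i
  exact abs_le.2 ⟨by linarith, by linarith⟩

/-- The denominator of the estimator is at least `1 / max φ` times the number of active iterations.
If there is none, the estimator has the junk value `0` and both sides vanish. -/
theorem abs_estimator_sub_PIP_mul_count_le {b : ℝ} (hb : ∀ γ, D.phi γ ≤ b) :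
    |D.estimator i T g q - D.PIP i| * ∑ t ∈ Finset.Icc 1 T, (if q t = true then 1 else 0) ≤
      b * |∑ t ∈ Finset.Icc 1 T, if q t = true then D.score i (g t) else 0| := by
  have hb0 : 0 ≤ b := (D.phi_pos i (g 0)).le.trans (hb _)
  set B := ∑ t ∈ Finset.Icc 1 T, if q t = true then (D.phi (g t))⁻¹ else 0 with hB
  have hcount : ∑ t ∈ Finset.Icc 1 T, (if q t = true then (1 : ℝ) else 0) ≤ b * B := by
    rw [hB, Finset.mul_sum]
    refine Finset.sum_le_sum fun t _ => ?_
    split_ifs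
    · have := D.phi_pos i (g t)
      rw [← div_eq_mul_inv, le_div_iff₀ this, one_mul]
      exact hb _
    · simp
  have hest : D.estimator i T g q =
      (∑ t ∈ Finset.Icc 1 T, if q t = true then (D.phi (g t))⁻¹ * D.condPosterior (g t) i true
        else 0) / B := by
    simp only [estimator, weight, rawWeight_mul_indicator]
    rw [Finset.sum_div]
    refine Finset.sum_congr rfl fun t _ => ?_
    split_ifs
    · rw [div_mul_eq_mul_div]
    · simp
  have hscore : |D.estimator i T g q - D.PIP i| * B ≤
      |∑ t ∈ Finset.Icc 1 T, if q t = true then D.score i (g t) else 0| := by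
    rcases eq_or_ne B 0 with h0 | h0
    · rw [h0, mul_zero]; exact abs_nonneg _
    · have hB0 : 0 ≤ B := Finset.sum_nonneg fun t _ => by
        have := (D.phi_pos i (g t)).le
        split_ifs <;> positivity
      rw [← abs_of_nonneg hB0, ← abs_mul, sub_mul, hest, div_mul_cancel₀ _ h0,
        hB, Finset.mul_sum, ← Finset.sum_sub_distrib]
      refine (congrArg _ (Finset.sum_congr rfl fun t _ => ?_)).le
      split_ifs
      · rw [score]; ring
      · simp
  calc _ ≤ |D.estimator i T g q - D.PIP i| * (b * B) := by gcongr
    _ = b * (|D.estimator i T g q - D.PIP i| * B) := by ring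
    _ ≤ _ := by gcongr

end Trajectory

section Run

/-- The state `(Q^{(t)}, γ^{(t)})` of the algorithm after iteration `t`. The variable `Q^{(0)}` is
not part of the algorithm and is replaced by a constant. -/
def runState {Ω : Type*} (γ : ℕ → Ω → Inclusion P) (Q : ℕ → Ω → Bool) (t : ℕ) (ω : Ω) :
    Bool × Inclusion P :=
  (if t = 0 then true else Q t ω, γ t ω)

/-- Transition probabilities of `runState` in iteration `t + 1`. -/
noncomputable def runTransition (S : ℝ) (t : ℕ) (e e' : Bool × Inclusion P) : ℝ :=
  D.qProb S (t + 1) e'.1 * D.moveProb e.2 e'.1 e'.2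

theorem sum_runTransition_mul (S : ℝ) (t : ℕ) (e : Bool × Inclusion P)
    (F : Bool × Inclusion P → ℝ) :
    ∑ e', D.runTransition S t e e' * F e' =
      D.qProb S (t + 1) true * ∑ j, D.selectProb e.2 j * F (true, flipAt e.2 j) +
        D.qProb S (t + 1) false * F (false, e.2) := by
  simp only [runTransition, Fintype.sum_prod_type, Fintype.sum_bool, moveProb, if_true, mul_assoc,
    Bool.false_eq_true, if_false, ← Finset.mul_sum]
  congr 2
  · simp only [Finset.sum_mul]
    rw [Finset.sum_comm]
    simp [ite_mul]
  · simp [ite_mul]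

variable {D} {S : ℝ} {Ω : Type*} [MeasurableSpace Ω] {μ : Measure Ω}
  {γ : ℕ → Ω → Inclusion P} {Q : ℕ → Ω → Bool}

theorem IsVCwTGSRun.measurable_runState (h : D.IsVCwTGSRun S μ γ Q) (t : ℕ) :
    Measurable (runState γ Q t) := by
  refine Measurable.prodMk ?_ (h.measurable_γ t)
  split_ifs
  exacts [measurable_const, h.measurable_Q t]

theorem IsVCwTGSRun.hasTransitions (h : D.IsVCwTGSRun S μ γ Q) :
    HasTransitions μ (runState γ Q) (D.runTransition S) := by
  intro T x
  by_cases hx : (x 0).1 = true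
  · have hset : ∀ T : ℕ, {ω | ∀ t ≤ T, runState γ Q t ω = x t} =
        {ω | γ 0 ω = (x 0).2 ∧ ∀ t ∈ Finset.Icc 1 T, Q t ω = (x t).1 ∧ γ t ω = (x t).2} := by
      intro T
      ext ω
      simp only [Set.mem_ofPred_eq, runState, Prod.ext_iff, Finset.mem_Icc]
      constructor
      · refine fun h1 => ⟨(h1 0 T.zero_le).2, fun t ht => ?_⟩
        simpa [show t ≠ 0 by omega] using h1 t ht.2
      · rintro ⟨h1, h2⟩ t ht
        rcases Nat.eq_zero_or_pos t with rfl | h0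
        · exact ⟨by simp [hx], h1⟩
        · simpa [h0.ne'] using h2 t ⟨h0, ht⟩
    have hlaw := fun T => h.path_law T (fun t => (x t).2) fun t => (x t).1
    rw [hset, hset, hlaw, hlaw, Finset.prod_Icc_succ_top (by omega), ← mul_assoc]
    rfl
  · have hset : ∀ T : ℕ, {ω | ∀ t ≤ T, runState γ Q t ω = x t} = ∅ := fun T =>
      Set.eq_empty_of_forall_notMem fun ω hω => hx (by rw [← hω 0 T.zero_le]; rfl)
    rw [hset, hset]
    simp

variable (D) in
/-- The martingale increment attached to the numerator of `estimator - PIP`; `v` is the corrector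
of the Poisson equation. -/
noncomputable def scoreIncrement (i : Fin P) (v : Inclusion P → ℝ) (e e' : Bool × Inclusion P) :
    ℝ :=
  (if e'.1 = true then D.score i e'.2 else 0) + v e'.2 - v e.2

/-- The centred indicator that iteration `t + 1` is active; the first iteration always is. -/
noncomputable def activeIncrement (p : ℝ) (t : ℕ) (e' : Bool × Inclusion P) : ℝ :=
  (if e'.1 = true then 1 else 0) - if t = 0 then 1 else p

variable (D) in
theorem sum_runTransition_mul_scoreIncrement {i : Fin P} {v : Inclusion P → ℝ}
    (hv : ∀ γ, ∑ j, D.selectProb γ j * (D.score i (flipAt γ j) + v (flipAt γ j) - v γ) = 0)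
    (t : ℕ) (e : Bool × Inclusion P) :
    ∑ e', D.runTransition S t e e' * D.scoreIncrement i v e e' = 0 := by
  rw [sum_runTransition_mul]
  simp [scoreIncrement, hv]

variable (D) in
theorem sum_runTransition_mul_activeIncrement (i : Fin P) (t : ℕ) (e : Bool × Inclusion P) :
    ∑ e', D.runTransition S t e e' * activeIncrement (S / P) t e' = 0 := by
  rw [sum_runTransition_mul]
  simp only [activeIncrement, ← Finset.sum_mul, D.sum_selectProb i, qProb]
  rcases Nat.eq_zero_or_pos t with rfl | ht
  · simp
  · simp [ht.ne']; ring

theorem abs_activeIncrement_le {p : ℝ} (hp : 0 ≤ p) (hp1 : p ≤ 1) (t : ℕ)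
    (e' : Bool × Inclusion P) : |activeIncrement p t e'| ≤ 1 := by
  rw [activeIncrement, abs_le]
  split_ifs <;> constructor <;> linarith

omit [MeasurableSpace Ω] in
/-- The error of the estimator after `T` iterations, times the expected number of active iterations
(up to a constant), is controlled by the two martingales. -/
theorem mul_abs_estimator_sub_PIP_le {i : Fin P} {v : Inclusion P → ℝ} {b V : ℝ}
    (hb : ∀ γ, D.phi γ ≤ b) (hV : ∀ γ, |v γ| ≤ V) {p : ℝ} (hp1 : p ≤ 1)
    (γ : ℕ → Ω → Inclusion P) (Q : ℕ → Ω → Bool) (T : ℕ) (ω : Ω) :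
    p * T * |D.estimator i T (fun t => γ t ω) (fun t => Q t ω) - D.PIP i| ≤
      |∑ t ∈ Finset.range T, activeIncrement p t (runState γ Q (t + 1) ω)| +
      b * |∑ t ∈ Finset.range T,
        D.scoreIncrement i v (runState γ Q t ω) (runState γ Q (t + 1) ω)| + (1 + 2 * b * V) := by
  set x := |D.estimator i T (fun t => γ t ω) (fun t => Q t ω) - D.PIP i| with hx
  have hx1 : x ≤ 1 := D.abs_estimator_sub_PIP_le_one i T _ _
  have hx0 : 0 ≤ x := abs_nonneg _
  have hb0 : 0 ≤ b := (D.phi_pos i (γ 0 ω)).le.trans (hb _)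
  have hkey := D.abs_estimator_sub_PIP_mul_count_le i T (fun t => γ t ω) (fun t => Q t ω) hb
  rw [sum_Icc_one_eq_sum_range, sum_Icc_one_eq_sum_range, ← hx] at hkey
  set n : ℝ := ∑ t ∈ Finset.range T, if Q (t + 1) ω = true then 1 else 0 with hn
  set m := ∑ t ∈ Finset.range T, if Q (t + 1) ω = true then D.score i (γ (t + 1) ω) else 0 with hm
  have hscore : ∑ t ∈ Finset.range T,
      D.scoreIncrement i v (runState γ Q t ω) (runState γ Q (t + 1) ω) =
      m + (v (γ T ω) - v (γ 0 ω)) := by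
    rw [hm, ← Finset.sum_range_sub (fun t => v (γ t ω)), ← Finset.sum_add_distrib]
    exact Finset.sum_congr rfl fun t _ => by simp [scoreIncrement, runState, add_sub_assoc]
  have hactive : ∑ t ∈ Finset.range T, activeIncrement p t (runState γ Q (t + 1) ω) =
      n - ∑ t ∈ Finset.range T, if t = 0 then 1 else p := by
    rw [hn, ← Finset.sum_sub_distrib]
    exact Finset.sum_congr rfl fun t _ => by simp [activeIncrement, runState]
  have hmean : p * T ≤ ∑ t ∈ Finset.range T, if t = 0 then 1 else p := by
    calc p * T = ∑ t ∈ Finset.range T, p := by simp [mul_comm]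
      _ ≤ _ := Finset.sum_le_sum fun t _ => by split_ifs <;> linarith
  set A := ∑ t ∈ Finset.range T, activeIncrement p t (runState γ Q (t + 1) ω)
  set Z := ∑ t ∈ Finset.range T, D.scoreIncrement i v (runState γ Q t ω) (runState γ Q (t + 1) ω)
  have h1 : p * T - n ≤ |A| := by
    have := neg_le_abs A
    linarith
  have h2 : |m| ≤ |Z| + 2 * V := by
    have : m = Z + (v (γ 0 ω) - v (γ T ω)) := by linarith
    rw [this]
    have h3 := abs_add_le Z (v (γ 0 ω) - v (γ T ω))
    have h4 := abs_sub (v (γ 0 ω)) (v (γ T ω))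
    have h5 := hV (γ 0 ω)
    have h6 := hV (γ T ω)
    linarith
  calc p * T * x = (p * T - n) * x + x * n := by ring
    _ ≤ |A| * x + b * |m| := by gcongr
    _ ≤ |A| * 1 + b * (|Z| + 2 * V) := by gcongr
    _ ≤ _ := by linarith

end Run

end BVSProblem

/-! ### Convergence and mean squared error -/

namespace BVSProblem

variable {N P : ℕ} {D : BVSProblem N P} {S : ℝ}

theorem IsVCwTGSRun.measurable_estimator {Ω : Type*} [MeasurableSpace Ω] {μ : Measure Ω}
    {γ : ℕ → Ω → Inclusion P} {Q : ℕ → Ω → Bool} (h : D.IsVCwTGSRun S μ γ Q) (i : Fin P) (T : ℕ) :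
    Measurable fun ω => D.estimator i T (fun t => γ t ω) (fun t => Q t ω) := by
  have h1 : ∀ t, Measurable fun ω =>
      D.rawWeight (γ t ω) (Q t ω) * if Q t ω = true then 1 else 0 := fun t =>
    (measurable_of_finite fun e : Inclusion P × Bool =>
      D.rawWeight e.1 e.2 * if e.2 = true then 1 else 0).comp
      ((h.measurable_γ t).prodMk (h.measurable_Q t))
  have h2 : ∀ t, Measurable fun ω => D.condPosterior (γ t ω) i true := fun t =>
    (measurable_of_finite fun g => D.condPosterior g i true).comp (h.measurable_γ t)
  exact Finset.measurable_sum _ fun t _ =>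
    ((h1 t).div (Finset.measurable_sum _ fun s _ => h1 s)).mul (h2 t)

theorem IsVCwTGSRun.integrable_sq_error {Ω : Type*} [MeasurableSpace Ω] {μ : Measure Ω}
    [IsProbabilityMeasure μ] {γ : ℕ → Ω → Inclusion P} {Q : ℕ → Ω → Bool}
    (h : D.IsVCwTGSRun S μ γ Q) (i : Fin P) (T : ℕ) :
    Integrable (fun ω => |D.estimator i T (fun t => γ t ω) (fun t => Q t ω) - D.PIP i| ^ 2) μ := by
  refine Integrable.of_bound
    (((h.measurable_estimator i T).sub_const _).abs.pow_const 2).aestronglyMeasurable 1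
    (ae_of_all _ fun ω => ?_)
  rw [Real.norm_of_nonneg (by positivity)]
  exact pow_le_one₀ (abs_nonneg _) (D.abs_estimator_sub_PIP_le_one i T _ _)

variable (D) in
/-- Consistency, and the mean squared error bound `K / ((S / P)² T)`, whose constant `K` depends
neither on the subset size nor on the run. -/
theorem exists_mse_bound (i : Fin P) : ∃ K : ℝ, ∀ S : ℝ, 0 < S → S ≤ P →
    ∀ (Ω : Type*) [MeasurableSpace Ω] (μ : Measure Ω) [IsProbabilityMeasure μ]
      (γ : ℕ → Ω → Inclusion P) (Q : ℕ → Ω → Bool), D.IsVCwTGSRun S μ γ Q →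
    (∀ᵐ ω ∂μ, Tendsto
      (fun T : ℕ => D.estimator i T (fun t => γ t ω) (fun t => Q t ω)) atTop (𝓝 (D.PIP i))) ∧
    ∀ T : ℕ, 1 ≤ T →
      (S / P * T) ^ 2 *
        ∫ ω, |D.estimator i T (fun t => γ t ω) (fun t => Q t ω) - D.PIP i| ^ 2 ∂μ ≤ K * T := by
  obtain ⟨v, hv⟩ := D.exists_corrector i
  obtain ⟨b, hb⟩ : ∃ b, ∀ γ, D.phi γ ≤ b := by
    obtain ⟨b, hb⟩ := (Set.finite_range D.phi).bddAbove
    exact ⟨b, fun γ => hb ⟨γ, rfl⟩⟩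
  obtain ⟨V, hV⟩ : ∃ V, ∀ γ, |v γ| ≤ V := by
    obtain ⟨V, hV⟩ := (Set.finite_range fun γ => |v γ|).bddAbove
    exact ⟨V, fun γ => hV ⟨γ, rfl⟩⟩
  obtain ⟨c, hc⟩ : ∃ c, ∀ e e', |D.scoreIncrement i v e e'| ≤ c := by
    obtain ⟨c, hc⟩ := (Set.finite_range fun e : (Bool × Inclusion P) × (Bool × Inclusion P) =>
      |D.scoreIncrement i v e.1 e.2|).bddAbove
    exact ⟨c, fun e e' => hc ⟨(e, e'), rfl⟩⟩
  refine ⟨3 * (1 + b ^ 2 * c ^ 2 + (1 + 2 * b * V) ^ 2), fun S hS hSP Ω _ μ _ γ Q h => ?_⟩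
  have hP : (0 : ℝ) < P := hS.trans_le hSP
  have hp : 0 < S / P := div_pos hS hP
  have hp1 : S / P ≤ 1 := (div_le_one hP).2 hSP
  have hX := h.measurable_runState
  have hk := h.hasTransitions
  have hd1 := fun t e => D.sum_runTransition_mul_activeIncrement (S := S) i t e
  have hd2 := fun t e => D.sum_runTransition_mul_scoreIncrement (S := S) hv t e
  have hc1 := abs_activeIncrement_le (P := P) hp.le hp1
  have hbound := mul_abs_estimator_sub_PIP_le (D := D) (i := i) hb hV hp1 γ Q
  constructor
  · filter_upwards [ae_tendsto_sum_div hX hk hd1 fun t _ e' => hc1 t e',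
      ae_tendsto_sum_div hX hk hd2 fun _ e e' => hc e e'] with ω h1 h2
    have h3 := ((h1.abs.add (h2.abs.const_mul b)).add
      (tendsto_const_div_atTop_nhds_zero_nat (1 + 2 * b * V))).const_mul (S / P)⁻¹
    simp only [abs_zero, mul_zero, add_zero] at h3
    refine tendsto_iff_norm_sub_tendsto_zero.2 (squeeze_zero' (Eventually.of_forall fun T =>
      norm_nonneg _) ?_ h3)
    filter_upwards [eventually_ge_atTop 1] with T hT
    have hT' : (0 : ℝ) < T := by exact_mod_cast hT
    rw [abs_div, abs_div, Nat.abs_cast, ← div_eq_inv_mul, le_div_iff₀ hp, mul_div_assoc' b,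
      ← add_div, ← add_div, le_div_iff₀ hT', Real.norm_eq_abs]
    exact (by ring : _ = _).trans_le (hbound T ω)
  · intro T hT
    have hT' : (1 : ℝ) ≤ T := by exact_mod_cast hT
    have hI1 := integrable_sum_sq (μ := μ) hX (fun t _ e' => activeIncrement (S / P) t e') T
    have hI2 := integrable_sum_sq (μ := μ) hX (fun _ e e' => D.scoreIncrement i v e e') T
    have h1 := integral_sum_sq_le hX hk hd1 (fun t _ e' => hc1 t e') T
    have h2 := integral_sum_sq_le hX hk hd2 (fun _ e e' => hc e e') T
    have hsq : ∀ a b c : ℝ, (a + b + c) ^ 2 ≤ 3 * (a ^ 2 + b ^ 2 + c ^ 2) := fun a b c => by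
      nlinarith [sq_nonneg (a - b), sq_nonneg (a - c), sq_nonneg (b - c)]
    rw [← integral_const_mul]
    calc _ ≤ ∫ ω, 3 * ((∑ t ∈ Finset.range T,
              activeIncrement (S / P) t (runState γ Q (t + 1) ω)) ^ 2 +
            b ^ 2 * (∑ t ∈ Finset.range T,
              D.scoreIncrement i v (runState γ Q t ω) (runState γ Q (t + 1) ω)) ^ 2 +
            (1 + 2 * b * V) ^ 2) ∂μ := by
          refine integral_mono ((h.integrable_sq_error i T).const_mul _)
            (((hI1.add (hI2.const_mul _)).add (integrable_const _)).const_mul _) fun ω => ?_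
          have h3 := pow_le_pow_left₀ (by positivity) (hbound T ω) 2
          refine (mul_pow _ _ 2).symm.trans_le (h3.trans ((hsq _ _ _).trans_eq ?_))
          simp only [mul_pow, sq_abs]
      _ = 3 * (∫ ω, (∑ t ∈ Finset.range T,
              activeIncrement (S / P) t (runState γ Q (t + 1) ω)) ^ 2 ∂μ +
            b ^ 2 * ∫ ω, (∑ t ∈ Finset.range T,
              D.scoreIncrement i v (runState γ Q t ω) (runState γ Q (t + 1) ω)) ^ 2 ∂μ +
            (1 + 2 * b * V) ^ 2) := by
          have h4 := integral_add (hI1.add (hI2.const_mul (b ^ 2)))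
            (integrable_const (μ := μ) ((1 + 2 * b * V) ^ 2))
          have h5 := integral_add hI1 (hI2.const_mul (b ^ 2))
          simp only [Pi.add_apply] at h4
          rw [integral_const_mul, h4, h5, integral_const_mul]
          simp
      _ ≤ 3 * (1 ^ 2 * T + b ^ 2 * (c ^ 2 * T) + (1 + 2 * b * V) ^ 2 * T) := by
          gcongr
          exact le_mul_of_one_le_right (sq_nonneg _) hT'
      _ = _ := by ring

variable (D) in
theorem one_le_iSup_phi_div_iInf_phi (i : Fin P) :
    1 ≤ (⨆ g : Inclusion P, D.phi g) / (⨅ g : Inclusion P, D.phi g) := by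
  obtain ⟨g, hg⟩ := exists_eq_ciInf_of_finite (f := D.phi)
  rw [← hg, one_le_div (D.phi_pos i g)]
  exact le_ciSup (Set.finite_range D.phi).bddAbove g

end BVSProblem

theorem theorem1 :
    ∃ C : ℝ, 0 < C ∧ ∀ (N P : ℕ) (D : BVSProblem N P), ∃ T₀ : ℕ,
      ∀ (i : Fin P) (S : ℝ), 0 < S → S ≤ P →
      ∀ (Ω : Type*) [MeasurableSpace Ω] (μ : Measure Ω) [IsProbabilityMeasure μ]
        (γ : ℕ → Ω → Inclusion P) (Q : ℕ → Ω → Bool), D.IsVCwTGSRun S μ γ Q →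
      (∀ᵐ ω ∂μ, Tendsto
        (fun T : ℕ => D.estimator i T (fun t => γ t ω) (fun t => Q t ω)) atTop (𝓝 (D.PIP i))) ∧
      ∀ T : ℕ, T₀ ≤ T →
        Integrable (fun ω =>
          |D.estimator i T (fun t => γ t ω) (fun t => Q t ω) - D.PIP i| ^ 2) μ ∧
        ∫ ω, |D.estimator i T (fun t => γ t ω) (fun t => Q t ω) - D.PIP i| ^ 2 ∂μ ≤
          C * (Real.log T / T * ((P : ℝ) / S) ^ 2 *
            ((⨆ g : Inclusion P, D.phi g) / (⨅ g : Inclusion P, D.phi g)) ^ 2) := by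
  refine ⟨1, one_pos, fun N P D => ?_⟩
  choose K hK using D.exists_mse_bound
  obtain ⟨B, hB⟩ := (Set.finite_range K).bddAbove
  -- The factor `log T` absorbs the constant `B`, which depends on the dataset.
  obtain ⟨T₁, hT₁⟩ := eventually_atTop.1
    ((Real.tendsto_log_atTop.comp tendsto_natCast_atTop_atTop).eventually_ge_atTop B)
  refine ⟨max 1 T₁, fun i S hS hSP Ω _ μ _ γ Q h => ?_⟩
  obtain ⟨hae, hmse⟩ := hK i S hS hSP Ω μ γ Q h
  refine ⟨hae, fun T hT => ⟨h.integrable_sq_error i T, ?_⟩⟩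
  have hT1 : 1 ≤ T := (le_max_left _ _).trans hT
  have hT' : (1 : ℝ) ≤ T := by exact_mod_cast hT1
  have hP : (0 : ℝ) < P := hS.trans_le hSP
  have hlog : K i ≤ Real.log T := (hB ⟨i, rfl⟩).trans (hT₁ T ((le_max_right _ _).trans hT))
  have hR := one_le_pow₀ (D.one_le_iSup_phi_div_iInf_phi i) (n := 2)
  have hlog0 : 0 ≤ Real.log T := Real.log_nonneg hT'
  have hm := (hmse T hT1).trans (mul_le_mul_of_nonneg_right hlog (by linarith))
  rw [one_mul]
  calc _ ≤ Real.log T * T / (S / P * T) ^ 2 := by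
        rw [le_div_iff₀ (by positivity), mul_comm]; exact hm
    _ = Real.log T / T * ((P : ℝ) / S) ^ 2 := by field_simp
    _ ≤ _ := le_mul_of_one_le_right (by positivity) hR
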